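/- Let $\mathcal X$ be a countably infinite alphabet, $\mathcal X^*=\{x^*: x\in\mathcal X\}$ a disjoint copy of it, and put $(x^*)^*=x$. Elements of $\mathcal X\cup\mathcal X^*$ are called variables, and finite sequences of variables are called words. For a word $\mathbf u$ let $\mathsf{con}(\mathbf u)$ be the set of variables occurring in $\mathbf u$ and $\mathsf{occ}(x,\mathbf u)$ the number of occurrences of the variable $x$ in $\mathbf u$. For variables $x,y$ with $y\ne x,x^*$, let $\mathbf u[x,y]$ be the word obtained from $\mathbf u$ by retaining only the variables $x,x^*,y,y^*$, and let $\overleftarrow{\mathsf{occ}}_y(x,\mathbf u)$ [resp. $\overrightarrow{\mathsf{occ}}_y(x,\mathbf u)$] be the number of occurrences of $x$ before the first [resp. after the last] occurrence of $y$ in $\mathbf u$ (all occurrences of $x$ if $y$ does not occur in $\mathbf u$). A word $\mathbf a'$ is a permutation of $\mathbf a$ if $\mathsf{occ}(z,\mathbf a')=\mathsf{occ}(z,\mathbf a)$ for every variable $z$. Write $W=\{x,x^*,y,y^*\}^{\times}$ for the set of all (possibly empty) words over $\{x,x^*,y,y^*\}$. Let $\mathcal A_3=\{1<2<3\}$. For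 a word $\mathbf w\in\mathcal A_3^\star$, let $\mathrm P(\mathbf w)$ be the pair of binary trees consisting of the left strict binary search tree obtained by inserting the symbols of $\mathbf w$ from left to right as leaves (a symbol $a$ goes to the left of a node labelled $b$ if $a<b$ and to the right otherwise), and the right strict binary search tree obtained by inserting the symbols of $\mathbf w$ from right to left as leaves ($a$ goes to the right of a node labelled $b$ if $a>b$ and to the left otherwise). The Baxter monoid $\mathsf{baxt}_3$ is the quotient of $\mathcal A_3^\star$ by the congruence $\mathbf w\equiv\mathbf w'\iff \mathrm P(\mathbf w)=\mathrm P(\mathbf w')$, and Schützenberger's involution ${}^\sharp$ on it is induced by $w_1\cdots w_k\mapsto w_k^\sharp\cdots w_1^\sharp$ with $1^\sharp=3$, $2^\sharp=2$, $3^\sharp=1$. A word identity $\mathbf u\approx\mathbf v$ ($\mathbf u,\mathbf v$ non-empty words) holds in $(\mathsf{baxt}_3,{}^\sharp)$ if $\varphi(\mathbf u)=\varphi(\mathbf v)$ for every substitution $\varphi:\mathcal X\to\mathsf{baxt}_3$, extended to words by $\varphi(x^*)=\varphi(x)^\sharp$ and multiplicativity. Theorem. A word identity $\mathbf u\approx\mathbf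 v$ holds in $(\mathsf{baxt}_3,{}^\sharp)$ if and only if it is balanced, i.e. $\mathsf{occ}(x,\mathbf u)=\mathsf{occ}(x,\mathbf v)$ for every $x\in\mathsf{con}(\mathbf u\mathbf v)$, and for every $x\in\mathsf{con}(\mathbf u)$ and every variable $y\in\mathcal X\cup\mathcal X^*$ (occurring in $\mathbf u$ or not) with $y\neq x,x^*$ the following conditions hold: (I) (a) if $\mathbf u[x,y]\in x^{\alpha}x^*W$ for some $\alpha\ge1$, then $\mathbf v[x,y]\in x^{\alpha}x^*W$; (b) if $\mathbf u[x,y]\in Wx^*x^{\alpha}$ for some $\alpha\ge1$, then $\mathbf v[x,y]\in Wx^*x^{\alpha}$. (II) (a) if $\mathbf u[x,y]\in y^{\alpha}xW$ for some $\alpha\ge1$, then $\mathbf v[x,y]\in y^{\alpha}xW$; (b) if $\mathbf u[x,y]\in Wxy^{\alpha}$ for some $\alpha\ge1$, then $\mathbf v[x,y]\in Wxy^{\alpha}$. (III) (a) if $\mathbf u[x,y]\in\mathbf a xW$ with $\mathsf{con}(\mathbf a)=\{x^*,y^*\}$, then $\mathbf v[x,y]\in\mathbf a'xW$ for some permutation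 $\mathbf a'$ of $\mathbf a$; (b) if $\mathbf u[x,y]\in Wx\mathbf a$ with $\mathsf{con}(\mathbf a)=\{x^*,y^*\}$, then $\mathbf v[x,y]\in Wx\mathbf a'$ for some permutation $\mathbf a'$ of $\mathbf a$. (IV) (a) $\overleftarrow{\mathsf{occ}}_y(x,\mathbf u)+\overleftarrow{\mathsf{occ}}_y(x^*,\mathbf u)=\overleftarrow{\mathsf{occ}}_y(x,\mathbf v)+\overleftarrow{\mathsf{occ}}_y(x^*,\mathbf v)$; (b) $\overrightarrow{\mathsf{occ}}_y(x,\mathbf u)+\overrightarrow{\mathsf{occ}}_y(x^*,\mathbf u)=\overrightarrow{\mathsf{occ}}_y(x,\mathbf v)+\overrightarrow{\mathsf{occ}}_y(x^*,\mathbf v)$. (V) (a) if $\mathbf u[x,y]\in\mathbf a yW$ with $\mathsf{con}(\mathbf a)=\{x,x^*\}$, then $\mathbf v[x,y]\in\mathbf a'yW$ for some permutation $\mathbf a'$ of $\mathbf a$; (b) if $\mathbf u[x,y]\in Wy\mathbf a$ with $\mathsf{con}(\mathbf a)=\{x,x^*\}$, then $\mathbf v[x,y]\in Wy\mathbf a'$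 for some permutation $\mathbf a'$ of $\mathbf a$. -/

import Mathlib

namespace Baxter

/-! ### Binary search trees and the Baxter congruence -/

section Trees

variable {α : Type*} [LinearOrder α]

/-- Insertion of a symbol into a right strict binary search tree: larger symbols go to the right
subtree, all others to the left subtree. -/
def insertR (a : α) : BinaryTree α → BinaryTree α
  | .nil => .node a .nil .nil
  | .node x l r => if x < a then .node x l (insertR a r) else .node x (insertR a l) r

/-- Insertion of a symbol into a left strict binary search tree: smaller symbols go to the left
subtree, all others to the right subtree. -/
def insertL (a : α) : BinaryTree α → BinaryTree α
  | .nil => .node a .nil .nil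
  | .node x l r => if a < x then .node x (insertL a l) r else .node x l (insertL a r)

/-- Insert the symbols of a word, read from left to right, into a left strict tree. -/
def insertLAll (w : List α) (t : BinaryTree α) : BinaryTree α :=
  w.foldl (fun t a => insertL a t) t

/-- The right strict binary search tree of a word, read from right to left. -/
def treeR (w : List α) : BinaryTree α :=
  w.foldr insertR .nil

/-- The left strict binary search tree of a word, read from left to right. -/
def treeL (w : List α) : BinaryTree α :=
  insertLAll w .nil

/-- The pair of twin binary search trees of a word. -/
def baxterP (w : List α) : BinaryTree α × BinaryTree α :=
  (treeL w, treeR w)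

/-! Auxiliary facts: the tree of `w₁ w₂` depends only on the trees of `w₁` and `w₂`. -/

/-- Remove from a tree all symbols that are not smaller than `x`. -/
def cutLT (x : α) : BinaryTree α → BinaryTree α
  | .nil => .nil
  | .node a l r => if a < x then .node a l (cutLT x r) else cutLT x l

/-- Remove from a tree all symbols that are smaller than `x`. -/
def cutGE (x : α) : BinaryTree α → BinaryTree α
  | .nil => .nil
  | .node a l r => if a < x then cutGE x r else .node a (cutGE x l) r

theorem cutLT_insertL (x b : α) (t : BinaryTree α) :
    cutLT x (insertL b t) = if b < x then insertL b (cutLT x t) else cutLT x t := by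
  induction t with
  | nil => by_cases h : b < x <;> simp [insertL, cutLT, h]
  | node a l r ihl ihr =>
    rcases lt_or_ge b a with h1 | h1 <;> rcases lt_or_ge a x with h2 | h2 <;>
      rcases lt_or_ge b x with h3 | h3 <;>
      simp_all [insertL, cutLT, not_lt_of_ge] <;> order

theorem cutGE_insertL (x b : α) (t : BinaryTree α) :
    cutGE x (insertL b t) = if b < x then cutGE x t else insertL b (cutGE x t) := by
  induction t with
  | nil => by_cases h : b < x <;> simp [insertL, cutGE, h]
  | node a l r ihl ihr =>
    rcases lt_or_ge b a with h1 | h1 <;> rcases lt_or_ge a x with h2 | h2 <;>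
      rcases lt_or_ge b x with h3 | h3 <;>
      simp_all [insertL, cutGE, not_lt_of_ge] <;> order

theorem insertLAll_append (u v : List α) (t : BinaryTree α) :
    insertLAll (u ++ v) t = insertLAll v (insertLAll u t) := by
  simp [insertLAll]

theorem cutLT_insertLAll (x : α) (w : List α) (t : BinaryTree α) :
    cutLT x (insertLAll w t) = insertLAll (w.filter (· < x)) (cutLT x t) := by
  induction w generalizing t with
  | nil => rfl
  | cons b w ih =>
    have := ih (insertL b t)
    rcases lt_or_ge b x with h | h
    · simp_all [insertLAll, cutLT_insertL]
    · simp_all [insertLAll, cutLT_insertL, not_lt_of_ge]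

theorem cutGE_insertLAll (x : α) (w : List α) (t : BinaryTree α) :
    cutGE x (insertLAll w t) = insertLAll (w.filter (x ≤ ·)) (cutGE x t) := by
  induction w generalizing t with
  | nil => rfl
  | cons b w ih =>
    have := ih (insertL b t)
    rcases lt_or_ge b x with h | h
    · simp_all [insertLAll, cutGE_insertL, not_le_of_gt]
    · simp_all [insertLAll, cutGE_insertL, not_lt_of_ge]

theorem insertLAll_node (w : List α) (a : α) (l r : BinaryTree α) :
    insertLAll w (.node a l r) =
      .node a (insertLAll (w.filter (· < a)) l) (insertLAll (w.filter (a ≤ ·)) r) := by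
  induction w generalizing l r with
  | nil => rfl
  | cons b w ih =>
    rcases lt_or_ge b a with h | h
    · simpa [insertLAll, insertL, h, not_le_of_gt h] using ih (insertL b l) r
    · simpa [insertLAll, insertL, h, not_lt_of_ge h] using ih l (insertL b r)

theorem insertLAll_congr {u v : List α} (h : treeL u = treeL v) (t : BinaryTree α) :
    insertLAll u t = insertLAll v t := by
  induction t generalizing u v with
  | nil => exact h
  | node a l r ihl ihr =>
    rw [insertLAll_node, insertLAll_node]
    congr 1
    · apply ihl
      have := congrArg (cutLT a) h
      simpa only [treeL, cutLT_insertLAll, cutLT] using this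
    · apply ihr
      have := congrArg (cutGE a) h
      simpa only [treeL, cutGE_insertLAll, cutGE] using this

theorem treeL_append {u u' v v' : List α} (hu : treeL u = treeL u') (hv : treeL v = treeL v') :
    treeL (u ++ v) = treeL (u' ++ v') := by
  have h := insertLAll_congr hv (treeL u)
  rw [treeL, treeL, insertLAll_append, insertLAll_append]
  rw [treeL, treeL] at hu
  rw [← hu]
  exact h

end Trees

section Words

variable {n : ℕ}

/-- The order-reversing anti-automorphism `w₁ ⋯ wₖ ↦ wₖ♯ ⋯ w₁♯` on words over the ordered
alphabet `Fin n` (the `n`-letter alphabet `1 < 2 < ⋯ < n`), where `♯` reverses the order. -/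
def sharpWord (w : List (Fin n)) : List (Fin n) :=
  (w.map Fin.rev).reverse

theorem sharpWord_sharpWord (w : List (Fin n)) : sharpWord (sharpWord w) = w := by
  simp [sharpWord, Function.comp_def]

theorem sharpWord_append (u v : List (Fin n)) :
    sharpWord (u ++ v) = sharpWord v ++ sharpWord u := by
  simp [sharpWord]

/-- Reflect a tree and reverse the order of its labels. -/
def mirror : BinaryTree (Fin n) → BinaryTree (Fin n)
  | .nil => .nil
  | .node a l r => .node a.rev (mirror r) (mirror l)

theorem mirror_mirror (t : BinaryTree (Fin n)) : mirror (mirror t) = t := by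
  induction t with
  | nil => rfl
  | node a l r ihl ihr => simp [mirror, ihl, ihr]

theorem mirror_insertR (a : Fin n) (t : BinaryTree (Fin n)) :
    mirror (insertR a t) = insertL a.rev (mirror t) := by
  induction t with
  | nil => rfl
  | node x l r ihl ihr =>
    by_cases h : x < a
    · simp [insertR, insertL, mirror, h, ihr]
    · simp [insertR, insertL, mirror, h, ihl]

theorem mirror_treeR (w : List (Fin n)) : mirror (treeR w) = treeL (sharpWord w) := by
  induction w with
  | nil => rfl
  | cons a w ih =>
    have h : treeR (a :: w) = insertR a (treeR w) := rfl
    rw [h, mirror_insertR, ih]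
    simp [treeL, insertLAll, sharpWord]

theorem treeR_eq_iff (u v : List (Fin n)) :
    treeR u = treeR v ↔ treeL (sharpWord u) = treeL (sharpWord v) := by
  rw [← mirror_treeR, ← mirror_treeR]
  exact ⟨fun h => by rw [h], fun h => by rw [← mirror_mirror (treeR u), h, mirror_mirror]⟩

theorem baxterP_append {u u' v v' : List (Fin n)} (hu : baxterP u = baxterP u')
    (hv : baxterP v = baxterP v') : baxterP (u ++ v) = baxterP (u' ++ v') := by
  simp only [baxterP, Prod.mk.injEq, treeR_eq_iff, sharpWord_append] at *
  exact ⟨treeL_append hu.1 hv.1, treeL_append hv.2 hu.2⟩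

theorem baxterP_sharp {u v : List (Fin n)} (h : baxterP u = baxterP v) :
    baxterP (sharpWord u) = baxterP (sharpWord v) := by
  simp only [baxterP, Prod.mk.injEq, treeR_eq_iff, sharpWord_sharpWord] at *
  exact ⟨h.2, h.1⟩

end Words

/-! ### The Baxter monoid of rank `n` and Schützenberger's involution -/

/-- Two words are related if and only if their pairs of twin binary search trees coincide. -/
def baxterCon (n : ℕ) : Con (FreeMonoid (Fin n)) where
  r u v := baxterP u.toList = baxterP v.toList
  iseqv := ⟨fun _ => rfl, fun h => h.symm, fun h h' => h.trans h'⟩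
  mul' hu hv := by
    simp only [FreeMonoid.toList_mul]
    exact baxterP_append hu hv

/-- The Baxter monoid of rank `n`. -/
def Baxt (n : ℕ) : Type :=
  (baxterCon n).Quotient

instance (n : ℕ) : Monoid (Baxt n) :=
  inferInstanceAs (Monoid (baxterCon n).Quotient)

/-- The class of a word in the Baxter monoid. -/
def Baxt.mk {n : ℕ} (w : List (Fin n)) : Baxt n :=
  ((FreeMonoid.ofList w : FreeMonoid (Fin n)) : (baxterCon n).Quotient)

/-- Schützenberger's involution `[w] ↦ [w♯]` on the Baxter monoid, as its `star`. -/
instance (n : ℕ) : StarMul (Baxt n) where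
  star := Quotient.lift (fun w : FreeMonoid (Fin n) => Baxt.mk (sharpWord w.toList))
    (fun _ _ h => (Con.eq (baxterCon n)).2 (baxterP_sharp h))
  star_involutive x := by
    induction x using Quotient.inductionOn with
    | h w => exact congrArg Baxt.mk (sharpWord_sharpWord w.toList)
  star_mul x y := by
    induction x using Quotient.inductionOn with
    | h u =>
      induction y using Quotient.inductionOn with
      | h v => exact congrArg Baxt.mk (sharpWord_append u.toList v.toList)

/-! ### Words with involution and word identities -/

/-- Variables, i.e. elements of the disjoint union of the countably infinite alphabet `ℕ`
(left summand) and its starred copy (right summand). -/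
abbrev Letter : Type := ℕ ⊕ ℕ

/-- The involution `x ↦ x*` on variables. -/
def Letter.st (x : Letter) : Letter := x.swap

/-- The unstarred variable underlying `x`. -/
def Letter.base (x : Letter) : ℕ := Sum.elim id id x

/-- The value of a word under a substitution into an involution monoid. -/
def evalWord {S : Type*} [Monoid S] [StarMul S] (φ : ℕ → S) (w : List Letter) : S :=
  (w.map (Sum.elim φ fun i => star (φ i))).prod

/-- The involution monoid `S` satisfies the word identity `u ≈ v`. -/
def Satisfies (S : Type*) [Monoid S] [StarMul S] (u v : List Letter) : Prop :=
  ∀ φ : ℕ → S, evalWord φ u = evalWord φ v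

/-- `occ(x, u)`: the number of occurrences of `x` in `u`. -/
def occ (x : Letter) (u : List Letter) : ℕ := u.count x

/-- `u[x, y]`: retain only the variables `x, x*, y, y*`. -/
def proj (u : List Letter) (x y : Letter) : List Letter :=
  u.filter fun z => z.base = x.base ∨ z.base = y.base

/-- The number of occurrences of `x` before the first occurrence of `y` in `u`
(all occurrences if `y` does not occur in `u`). -/
def occBefore (y x : Letter) (u : List Letter) : ℕ := occ x (u.takeWhile (· ≠ y))

/-- The number of occurrences of `x` after the last occurrence of `y` in `u`
(all occurrences if `y` does not occur in `u`). -/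
def occAfter (y x : Letter) (u : List Letter) : ℕ := occ x (u.rtakeWhile (· ≠ y))

/-- A word identity `u ≈ v` is balanced. -/
def Balanced (u v : List Letter) : Prop :=
  ∀ x ∈ u ++ v, occ x u = occ x v

/-- `a'` is a permutation of `a`. -/
def IsPermutation (a' a : List Letter) : Prop :=
  ∀ x : Letter, occ x a' = occ x a

/-- `con(a) = {p, q}`. -/
def ContentEq (a : List Letter) (p q : Letter) : Prop :=
  ∀ z : Letter, z ∈ a ↔ z = p ∨ z = q

/-! In the conditions below, `p <+: w` and `p <:+ w` say that `p` is a prefix, resp. a suffix,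
of `w`. -/

/-- Condition (I). -/
def CondI (u v : List Letter) (x y : Letter) : Prop :=
  (∀ α : ℕ, 1 ≤ α → List.replicate α x ++ [x.st] <+: proj u x y →
    List.replicate α x ++ [x.st] <+: proj v x y) ∧
  (∀ α : ℕ, 1 ≤ α → [x.st] ++ List.replicate α x <:+ proj u x y →
    [x.st] ++ List.replicate α x <:+ proj v x y)

/-- Condition (II). -/
def CondII (u v : List Letter) (x y : Letter) : Prop :=
  (∀ α : ℕ, 1 ≤ α → List.replicate α y ++ [x] <+: proj u x y →
    List.replicate α y ++ [x] <+: proj v x y) ∧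
  (∀ α : ℕ, 1 ≤ α → [x] ++ List.replicate α y <:+ proj u x y →
    [x] ++ List.replicate α y <:+ proj v x y)

/-- Condition (III). -/
def CondIII (u v : List Letter) (x y : Letter) : Prop :=
  (∀ a : List Letter, ContentEq a x.st y.st → a ++ [x] <+: proj u x y →
    ∃ a' : List Letter, IsPermutation a' a ∧ a' ++ [x] <+: proj v x y) ∧
  (∀ a : List Letter, ContentEq a x.st y.st → [x] ++ a <:+ proj u x y →
    ∃ a' : List Letter, IsPermutation a' a ∧ [x] ++ a' <:+ proj v x y)

/-- Condition (IV). -/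
def CondIV (u v : List Letter) (x y : Letter) : Prop :=
  occBefore y x u + occBefore y x.st u = occBefore y x v + occBefore y x.st v ∧
  occAfter y x u + occAfter y x.st u = occAfter y x v + occAfter y x.st v

/-- Condition (V). -/
def CondV (u v : List Letter) (x y : Letter) : Prop :=
  (∀ a : List Letter, ContentEq a x x.st → a ++ [y] <+: proj u x y →
    ∃ a' : List Letter, IsPermutation a' a ∧ a' ++ [y] <+: proj v x y) ∧
  (∀ a : List Letter, ContentEq a x x.st → [y] ++ a <:+ proj u x y →
    ∃ a' : List Letter, IsPermutation a' a ∧ [y] ++ a' <:+ proj v x y)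

end Baxter

namespace Baxter

/-! ### Prefixes before the first occurrence of a symbol -/

section Prefix

variable {β : Type*}

/-! Both sides of the equivalence split into a left half and its mirror image. Reflection turns
right strict trees into left strict trees of the word under `sharpWord`, and `sharpWord` of an image
of `u` is an image of `u.reverse`. So the identity holds iff `SameTreeL` holds for `u, v` and for
their reversals (`satisfies_iff_sameTreeL`). Likewise each suffix condition is the prefix condition
for the reversed words (`conds_iff_leftCond`). Only the one-sided statement remains, and it passes
through the intermediate description `LeftSim`.

`SameTreeL` ⇔ `LeftSim`: the left strict tree of a word is fixed by its letter counts and by the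
numbers of `a` before the first `b`, for `a < b` (`treeL_eq_of_counts`). For consecutive `a, b`
these numbers can be read off the tree (`labelPre_treeL`). In an image of `u`, the first `b` comes
from the first variable `z` whose image contains `b`. The letters `0, 1, 2` stand for `1, 2, 3`, so
the involution swaps `0` and `2` and fixes `1`. Before the first `2`, variables therefore matter
only up to `*`. Before the first `1`, the variable `z.st` cannot precede `z`, and exact counts
matter. This yields the fields of `LeftSim`; substitutions in at most two variables show that each
is necessary.

`LeftSim` ⇔ balanced and `LeftCond`: the prefix conditions are special cases of `LeftSim`.
Conversely, the first three force the same order of first occurrences, the fourth gives the sums,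
and the fifth gives the separate counts when both `x` and `x.st` precede `y` but `y.st` does not. -/

theorem takeWhile_flatMap {γ : Type*} (f : β → List γ) (p : γ → Bool) (u : List β) :
    (u.flatMap f).takeWhile p = (u.takeWhile fun t => !(f t).any fun c => !p c).flatMap f ++
      ((u.find? fun t => (f t).any fun c => !p c).elim [] fun z => (f z).takeWhile p) := by
  induction u with
  | nil => rfl
  | cons c u ih =>
    by_cases hc : ∀ d ∈ f c, p d
    · have : (f c).any (fun d => !p d) = false := by simpa using hc
      rw [List.flatMap_cons, List.takeWhile_append_of_pos hc, ih]
      simp [this]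
    · have h : (f c).any (fun d => !p d) = true := by simpa using hc
      rw [List.flatMap_cons, List.takeWhile_append, List.takeWhile_cons, List.find?_cons, h]
      have : ((f c).takeWhile p).length ≠ (f c).length := fun hl => hc <| by
        have := (List.takeWhile_prefix p).eq_of_length hl
        exact List.takeWhile_eq_self_iff.1 this
      simp [this]

variable [DecidableEq β]

/-- The longest prefix of `u` in which `z` does not occur. -/
def pre (z : β) (u : List β) : List β := u.takeWhile (· ≠ z)

@[simp] theorem pre_nil (z : β) : pre z [] = [] := rfl

theorem pre_cons (z x : β) (u : List β) :
    pre z (x :: u) = if x = z then [] else x :: pre z u := by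
  by_cases h : x = z <;> simp [pre, h]

@[simp] theorem pre_cons_self (z : β) (u : List β) : pre z (z :: u) = [] := by
  simp [pre_cons]

theorem pre_cons_of_ne {z x : β} (h : x ≠ z) (u : List β) : pre z (x :: u) = x :: pre z u := by
  simp [pre_cons, h]

theorem not_mem_pre (z : β) (u : List β) : z ∉ pre z u := by
  induction u with
  | nil => simp
  | cons x u ih => by_cases h : x = z <;> simp [pre_cons, h, ih, Ne.symm (a := x) (b := z)]

theorem ne_of_mem_pre {x z : β} {u : List β} (h : x ∈ pre z u) : x ≠ z := by
  rintro rfl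
  exact not_mem_pre x u h

theorem pre_of_not_mem {z : β} {u : List β} (h : z ∉ u) : pre z u = u := by
  induction u with
  | nil => rfl
  | cons x u ih =>
    rw [List.mem_cons, not_or] at h
    rw [pre_cons_of_ne (Ne.symm h.1), ih h.2]

theorem mem_of_mem_pre {x z : β} {u : List β} (h : x ∈ pre z u) : x ∈ u :=
  (List.takeWhile_sublist _).subset h

/-- Reading `x ∈ pre y u` as "`x` first occurs before `y`", this is totality of the order of first
occurrences; `mem_pre_trans` and `not_mem_pre_of_mem_pre` are its transitivity and asymmetry. -/
theorem mem_pre_of_not_mem_pre {x y : β} {u : List β} (hx : x ∈ u) (hne : y ≠ x)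
    (h : y ∉ pre x u) : x ∈ pre y u := by
  induction u with
  | nil => simp at hx
  | cons c u ih =>
    by_cases hc : c = x
    · subst hc
      simp [pre_cons_of_ne hne.symm]
    · rw [pre_cons_of_ne hc, List.mem_cons, not_or] at h
      rw [pre_cons_of_ne (Ne.symm h.1)]
      exact List.mem_cons_of_mem _ (ih ((List.mem_cons.1 hx).resolve_left (Ne.symm hc)) h.2)

theorem mem_pre_trans {x y z : β} {u : List β} (hx : x ∈ pre z u) (hy : y ∉ pre z u) :
    x ∈ pre y u := by
  induction u with
  | nil => simp at hx
  | cons c u ih =>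
    by_cases hc : c = z
    · simp [hc] at hx
    · rw [pre_cons_of_ne hc] at hx hy
      rw [List.mem_cons, not_or] at hy
      rw [pre_cons_of_ne (Ne.symm hy.1)]
      rcases List.mem_cons.1 hx with rfl | hx
      · exact List.mem_cons_self
      · exact List.mem_cons_of_mem _ (ih hx hy.2)

theorem not_mem_pre_of_mem_pre {x y : β} {u : List β} (h : x ∈ pre y u) : y ∉ pre x u := by
  induction u with
  | nil => simp at h
  | cons c u ih =>
    by_cases hc : c = x
    · simp [hc]
    · by_cases hc' : c = y
      · simp [hc'] at h
      · rw [pre_cons_of_ne hc'] at h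
        rw [pre_cons_of_ne hc, List.mem_cons, not_or]
        exact ⟨Ne.symm hc', ih ((List.mem_cons.1 h).resolve_left (Ne.symm hc))⟩

theorem pre_filter {q : β → Bool} {z : β} (hz : q z) (u : List β) :
    pre z (u.filter q) = (pre z u).filter q := by
  induction u with
  | nil => rfl
  | cons c u ih =>
    by_cases hc : c = z
    · subst hc
      simp [hz]
    · by_cases hq : q c <;> simp [pre_cons, hc, hq, ih]

theorem count_pre_filter {q : β → Bool} {a b : β} (ha : q a) (hb : q b) (u : List β) :
    (pre b (u.filter q)).count a = (pre b u).count a := by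
  rw [pre_filter hb, List.count_filter ha]

theorem count_pre_filter_of_not {q : β → Bool} {a : β} (ha : ¬ q a) (b : β) (u : List β) :
    (pre b (u.filter q)).count a = 0 :=
  List.count_eq_zero.2 fun h => ha (List.mem_filter.1 (mem_of_mem_pre h)).2

/-- Turns the prefix conditions of the theorem into statements about first occurrences. -/
theorem append_singleton_prefix_iff {z : β} {a w : List β} (hz : z ∉ a) :
    a ++ [z] <+: w ↔ z ∈ w ∧ pre z w = a := by
  induction w generalizing a with
  | nil => simp
  | cons c w ih =>
    cases a with
    | nil =>
      by_cases hc : c = z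
      · simp [hc]
      · simp [pre_cons, hc, Ne.symm hc]
    | cons d a =>
      rw [List.mem_cons, not_or] at hz
      rw [List.cons_append, List.cons_prefix_cons, ih hz.2, pre_cons, List.mem_cons]
      by_cases hc : c = z
      · subst hc
        simp [Ne.symm hz.1]
      · simp only [hc, Ne.symm hc, if_false, false_or, List.cons.injEq]
        grind

theorem takeWhile_eq_pre {p : β → Bool} {u : List β} {z : β} (h : u.find? p = some z) :
    u.takeWhile (fun t => !p t) = pre z u := by
  induction u with
  | nil => simp at h
  | cons c u ih =>
    by_cases hc : p c
    · simp only [List.find?_cons, hc, Option.some.injEq] at h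
      simp [← h, hc]
    · have hz : p z := List.find?_some h
      have hcz : c ≠ z := by rintro rfl; exact hc hz
      simp only [List.find?_cons, hc] at h
      simp [hc, pre_cons_of_ne hcz, ih h]

end Prefix

/-! ### Invariants of left strict binary search trees -/

section TreeInvariants

variable {α : Type*} [LinearOrder α]

theorem treeL_cons (x : α) (w : List α) :
    treeL (x :: w) = .node x (treeL (w.filter (· < x))) (treeL (w.filter (x ≤ ·))) := by
  exact insertLAll_node w x .nil .nil

/-- The hypotheses force equal first letters, hence equal roots, and they pass to the two filtered
words that build the subtrees. -/
theorem treeL_eq_of_counts {u v : List α} (hc : ∀ a, u.count a = v.count a)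
    (hp : ∀ a b, a < b → (pre b u).count a = (pre b v).count a) : treeL u = treeL v := by
  induction hn : u.length using Nat.strong_induction_on generalizing u v with
  | _ n ih =>
    have perm : u.Perm v := List.perm_iff_count.2 hc
    cases u with
    | nil => rw [perm.nil_eq]
    | cons x u =>
      cases v with
      | nil => simp at perm
      | cons y v =>
        -- If the heads differ, the smaller one occurs before the first larger one in exactly one of
        -- the two words.
        obtain rfl : x = y := by
          rcases lt_trichotomy x y with h | h | h
          · have := hp x y h
            simp [pre_cons, h.ne] at this
          · exact h
          · have := hp y x h
            simp [pre_cons, h.ne] at this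
        have hc' : ∀ a, u.count a = v.count a := fun a => by
          have := hc a
          simpa [List.count_cons] using this
        have hp' : ∀ a b, b ≠ x → a < b → (pre b u).count a = (pre b v).count a := by
          intro a b hb hab
          have := hp a b hab
          simpa [pre_cons, hb.symm, List.count_cons] using this
        have hf : ∀ (q : α → Bool) (a : α), (u.filter q).count a = (v.filter q).count a := by
          intro q a
          by_cases hq : q a
          · rw [List.count_filter hq, List.count_filter hq, hc']
          · rw [List.count_eq_zero.2 (by simp [hq]), List.count_eq_zero.2 (by simp [hq])]
        -- Once the head is removed, nothing is known about prefixes before the next `x`. So a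
        -- filter must not retain `x` together with a smaller letter.
        have key : ∀ q : α → Bool, (∀ a, q a → a < x → ¬ q x) →
            treeL (u.filter q) = treeL (v.filter q) := by
          intro q hq
          refine ih _ ?_ (hf q) ?_ rfl
          · rw [← hn]
            exact Nat.lt_succ_of_le (List.length_filter_le _ _)
          · intro a b hab
            by_cases ha : q a
            · by_cases hb : q b
              · rw [count_pre_filter ha hb, count_pre_filter ha hb]
                exact hp' a b (by rintro rfl; exact hq a ha hab hb) hab
              · rw [pre_of_not_mem (by simp [hb]), pre_of_not_mem (by simp [hb]), hf]
            · rw [count_pre_filter_of_not ha, count_pre_filter_of_not ha]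
        rw [treeL_cons, treeL_cons, key, key]
        · intro a ha hax
          simp [not_le_of_gt hax] at ha
        · simp
/-- The number of nodes labelled `a`. -/
def labelCount (a : α) : BinaryTree α → ℕ
  | .nil => 0
  | .node x l r => (if x = a then 1 else 0) + labelCount a l + labelCount a r

theorem labelCount_treeL (a : α) (w : List α) : labelCount a (treeL w) = w.count a := by
  induction hn : w.length using Nat.strong_induction_on generalizing w with
  | _ n ih =>
    cases w with
    | nil => rfl
    | cons x w =>
      have hlt : ∀ q : α → Bool, (w.filter q).length < n := fun q => by
        rw [← hn]
        exact Nat.lt_succ_of_le (List.length_filter_le _ _)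
      rw [treeL_cons, labelCount, ih _ (hlt _) _ rfl, ih _ (hlt _) _ rfl, List.count_cons]
      rcases lt_or_ge a x with h | h
      · rw [List.count_filter (by simpa using h),
          show (w.filter (x ≤ ·)).count a = 0 from List.count_eq_zero.2 (by simp [h])]
        simp [add_comm]
      · rw [List.count_filter (p := (x ≤ ·)) (by simpa using h),
          show (w.filter (· < x)).count a = 0 from List.count_eq_zero.2 (by simp [h])]
        simp [add_comm]

/-- For consecutive labels `a < b`, the number of labels `a` inserted into a left strict tree
before the first label `b`. -/
def labelPre (a b : α) : BinaryTree α → ℕ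
  | .nil => 0
  | .node x l r =>
    if x = b then 0 else if b < x then labelPre a b l
    else (if x = a then 1 else 0) + labelPre a b r

/-- Since no label lies strictly between `a` and `b`, a root other than `b` sends later copies of
both to the same subtree, so a single path suffices. Without `a ⋖ b` a root in between would
separate them and the relative order would be lost. -/
theorem labelPre_treeL {a b : α} (h : a ⋖ b) (w : List α) :
    labelPre a b (treeL w) = (pre b w).count a := by
  induction hn : w.length using Nat.strong_induction_on generalizing w with
  | _ n ih =>
    cases w with
    | nil => rfl
    | cons x w =>
      have hlt : ∀ q : α → Bool, (w.filter q).length < n := fun q => by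
        rw [← hn]
        exact Nat.lt_succ_of_le (List.length_filter_le _ _)
      rw [treeL_cons, labelPre, ih _ (hlt _) _ rfl, ih _ (hlt _) _ rfl, pre_cons]
      rcases lt_trichotomy x b with hx | hx | hx
      · have hxa : x ≤ a := not_lt.1 fun h' => h.2 h' hx
        rw [if_neg hx.ne, if_neg hx.ne, if_neg hx.not_gt, List.count_cons,
          count_pre_filter (by simpa using hxa) (by simpa using hx.le)]
        simp [add_comm]
      · simp [hx]
      · rw [if_neg hx.ne', if_neg hx.ne', if_pos hx, List.count_cons,
          count_pre_filter (by simpa using h.1.trans hx) (by simpa using hx)]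
        simp [(h.1.trans hx).ne']

end TreeInvariants

/-! ### Prefixes of substituted words -/

section Prefix

variable {β : Type*} {γ : Type*} [DecidableEq γ]

theorem count_flatMap (f : β → List γ) (a : γ) (u : List β) :
    (u.flatMap f).count a = (u.map fun t => (f t).count a).sum := by
  rw [List.count_flatMap]
  rfl

theorem count_pre_flatMap_of_find?_none {f : β → List γ} {b : γ} {u : List β}
    (h : u.find? (fun t => decide (b ∈ f t)) = none) (a : γ) :
    (pre b (u.flatMap f)).count a = (u.map fun t => (f t).count a).sum := by
  rw [pre_of_not_mem, count_flatMap]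
  simpa using h

variable [DecidableEq β]

theorem find?_eq_some_of_pre {p : β → Bool} {u : List β} {z : β} (hz : z ∈ u) (hp : p z)
    (h : ∀ t ∈ pre z u, ¬ p t) : u.find? p = some z := by
  induction u with
  | nil => simp at hz
  | cons c u ih =>
    by_cases hc : c = z
    · subst hc
      simp [hp]
    · rw [pre_cons_of_ne hc] at h
      rw [List.find?_cons, Bool.eq_false_iff.2 (h c List.mem_cons_self)]
      exact ih ((List.mem_cons.1 hz).resolve_left (Ne.symm hc))
        fun t ht => h t (List.mem_cons_of_mem _ ht)

theorem not_of_mem_pre_of_find? {p : β → Bool} {u : List β} {z t : β} (h : u.find? p = some z)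
    (ht : t ∈ pre z u) : ¬ p t := by
  rw [← takeWhile_eq_pre h] at ht
  simpa using List.mem_takeWhile_imp ht

/-- The first `b` lies in the image of `z`: all variables before `z` contribute their whole images,
and `z` contributes the part of its image before `b`. -/
theorem count_pre_flatMap_of_find? {f : β → List γ} {b : γ} {u : List β} {z : β}
    (h : u.find? (fun t => decide (b ∈ f t)) = some z) (a : γ) :
    (pre b (u.flatMap f)).count a =
      ((pre z u).map fun t => (f t).count a).sum + (pre b (f z)).count a := by
  have hp : (fun t => (f t).any fun c => !decide (c ≠ b)) = fun t => decide (b ∈ f t) := by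
    funext t
    simp [List.any_eq, eq_comm]
  rw [pre, takeWhile_flatMap, hp, h]
  have := takeWhile_eq_pre h
  rw [List.count_append, count_flatMap, ← this]
  congr 4
  funext t
  exact congrArg not (congrFun hp t)

end Prefix

/-! ### Variables and equivariant substitutions -/

instance {α β : Type*} [BEq α] [BEq β] [LawfulBEq α] [LawfulBEq β] : LawfulBEq (α ⊕ β) where
  eq_of_beq {a b} h := by
    cases a <;> cases b
    · exact congrArg Sum.inl (eq_of_beq h)
    · cases h
    · cases h
    · exact congrArg Sum.inr (eq_of_beq h)
  rfl {a} := by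
    cases a with
    | inl a => exact beq_self_eq_true a
    | inr b => exact beq_self_eq_true b

namespace Letter

@[simp] theorem st_st (x : Letter) : x.st.st = x := Sum.swap_swap x

theorem st_ne (x : Letter) : x.st ≠ x := by
  cases x <;> simp [st]

theorem st_eq_iff {x y : Letter} : x.st = y ↔ x = y.st :=
  ⟨fun h => by rw [← h, st_st], fun h => by rw [h, st_st]⟩

@[simp] theorem base_st (x : Letter) : x.st.base = x.base := by
  cases x <;> rfl

theorem base_eq_iff {x y : Letter} : x.base = y.base ↔ x = y ∨ x = y.st := by
  cases x <;> cases y <;> simp [base, st]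

end Letter

/-- Substitutions that commute with the involutions. -/
def Equivariant (F : Letter → List (Fin 3)) : Prop :=
  ∀ x, F x.st = sharpWord (F x)

/-- The substitution with `z ↦ w`, `x ↦ w'`, and all variables other than `z, z*, x, x*`
erased. -/
def substTwo (z : Letter) (w : List (Fin 3)) (x : Letter) (w' : List (Fin 3)) (t : Letter) :
    List (Fin 3) :=
  if t = z then w else if t = z.st then sharpWord w else
    if t = x then w' else if t = x.st then sharpWord w' else []

section substTwo

variable {z x : Letter} {w w' : List (Fin 3)}

theorem substTwo_left : substTwo z w x w' z = w := by
  simp [substTwo]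

theorem substTwo_left_st : substTwo z w x w' z.st = sharpWord w := by
  simp [substTwo, Letter.st_ne]

theorem substTwo_right (h : x ≠ z) (h' : x ≠ z.st) : substTwo z w x w' x = w' := by
  simp [substTwo, h, h']

theorem substTwo_right_st (h : x ≠ z) (h' : x ≠ z.st) :
    substTwo z w x w' x.st = sharpWord w' := by
  have h1 : x.st ≠ z := fun e => h' (Letter.st_eq_iff.1 e)
  have h2 : x.st ≠ z.st := fun e => h (by rw [← x.st_st, e, z.st_st])
  simp [substTwo, h1, h2, Letter.st_ne]

theorem substTwo_other {t : Letter} (h1 : t ≠ z) (h2 : t ≠ z.st) (h3 : t ≠ x) (h4 : t ≠ x.st) :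
    substTwo z w x w' t = [] := by
  simp [substTwo, h1, h2, h3, h4]

theorem equivariant_substTwo (h : x ≠ z) (h' : x ≠ z.st) : Equivariant (substTwo z w x w') := by
  intro t
  by_cases h1 : t = z
  · rw [h1, substTwo_left, substTwo_left_st]
  by_cases h2 : t = z.st
  · rw [h2, Letter.st_st, substTwo_left, substTwo_left_st, sharpWord_sharpWord]
  by_cases h3 : t = x
  · rw [h3, substTwo_right h h', substTwo_right_st h h']
  by_cases h4 : t = x.st
  · rw [h4, Letter.st_st, substTwo_right h h', substTwo_right_st h h', sharpWord_sharpWord]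
  rw [substTwo_other h1 h2 h3 h4, substTwo_other]
  · rfl
  · rwa [Ne, Letter.st_eq_iff]
  · rwa [Ne, Letter.st_eq_iff, Letter.st_st]
  · rwa [Ne, Letter.st_eq_iff]
  · rwa [Ne, Letter.st_eq_iff, Letter.st_st]

theorem sum_count_substTwo (h : x ≠ z) (h' : x ≠ z.st) (a : Fin 3) (l : List Letter) :
    (l.map fun t => (substTwo z w x w' t).count a).sum =
      l.count z * w.count a + l.count z.st * (sharpWord w).count a +
        l.count x * w'.count a + l.count x.st * (sharpWord w').count a := by
  have hs : x.st ≠ z := fun e => h' (Letter.st_eq_iff.1 e)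
  have hs' : x.st ≠ z.st := fun e => h (by rw [← x.st_st, e, z.st_st])
  induction l with
  | nil => simp
  | cons t l ih =>
    rw [List.map_cons, List.sum_cons, ih]
    simp only [List.count_cons, beq_iff_eq]
    by_cases h1 : t = z
    · subst h1
      simp [substTwo_left, h.symm, hs.symm, (Letter.st_ne t).symm]
      ring
    by_cases h2 : t = z.st
    · subst h2
      simp [substTwo_left_st, h'.symm, hs'.symm, Letter.st_ne]
      ring
    by_cases h3 : t = x
    · subst h3
      simp [substTwo_right h h', h, h', (Letter.st_ne t).symm]
      ring
    by_cases h4 : t = x.st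
    · subst h4
      simp [substTwo_right_st h h', hs, hs', Letter.st_ne]
      ring
    simp [substTwo_other h1 h2 h3 h4, h1, h2, h3, h4]

end substTwo

/-- Such a weight depends only on the underlying unstarred variable, and the two lists of underlying
variables are permutations of each other. -/
theorem sum_map_eq_of_st_invariant {l l' : List Letter} {g : Letter → ℕ}
    (hg : ∀ x : Letter, g x.st = g x)
    (h : ∀ x : Letter, l.count x + l.count x.st = l'.count x + l'.count x.st) :
    (l.map g).sum = (l'.map g).sum := by
  have hcount : ∀ (l : List Letter) (n : ℕ),
      (l.map Letter.base).count n = l.count (.inl n) + l.count (.inr n) := by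
    intro l n
    induction l with
    | nil => rfl
    | cons t l ih =>
      rw [List.map_cons, List.count_cons, ih]
      cases t <;> simp [List.count_cons, Letter.base] <;> ring
  have hperm : (l.map Letter.base).Perm (l'.map Letter.base) :=
    List.perm_iff_count.2 fun n => by
      rw [hcount, hcount]
      exact h (.inl n)
  have hmap : ∀ l : List Letter, l.map g = (l.map Letter.base).map fun n => g (.inl n) := by
    intro l
    rw [List.map_map]
    refine List.map_congr_left fun t _ => ?_
    cases t with
    | inl n => rfl
    | inr n => exact hg (.inl n)
  rw [hmap, hmap]
  exact (hperm.map _).sum_eq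

/-! ### Word identities under left strict trees -/

/-- All equivariant substitutions yield words with equal left strict trees. -/
def SameTreeL (u v : List Letter) : Prop :=
  ∀ F, Equivariant F → treeL (u.flatMap F) = treeL (v.flatMap F)

/-- The combinatorial description of `SameTreeL`. -/
structure LeftSim (u v : List Letter) : Prop where
  count : ∀ x : Letter, u.count x = v.count x
  mem_pre : ∀ x y : Letter, x ∈ pre y u ↔ x ∈ pre y v
  count_add : ∀ x y : Letter,
    (pre y u).count x + (pre y u).count x.st = (pre y v).count x + (pre y v).count x.st
  count_pre : ∀ x y : Letter, y.st ∉ pre y u → (pre y u).count x = (pre y v).count x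

namespace LeftSim

variable {u v : List Letter}

theorem perm (h : LeftSim u v) : u.Perm v := List.perm_iff_count.2 h.count

theorem find?_eq (h : LeftSim u v) (p : Letter → Bool) : u.find? p = v.find? p := by
  cases hu : u.find? p with
  | none =>
    symm
    rw [List.find?_eq_none] at hu ⊢
    exact fun x hx => hu x (h.perm.mem_iff.2 hx)
  | some z =>
    symm
    exact find?_eq_some_of_pre (h.perm.mem_iff.1 (List.mem_of_find?_eq_some hu))
      (List.find?_some hu) fun t ht => not_of_mem_pre_of_find? hu ((h.mem_pre t z).2 ht)

theorem sameTreeL (h : LeftSim u v) : SameTreeL u v := by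
  intro F hF
  have hst : ∀ (x : Letter) (a : Fin 3), (F x.st).count a = (F x).count a.rev := by
    intro x a
    rw [hF, sharpWord, List.count_reverse, ← Fin.rev_rev a,
      List.count_map_of_injective _ _ Fin.rev_injective, Fin.rev_rev]
  have hperm := h.perm.flatMap_right F
  refine treeL_eq_of_counts (fun a => hperm.count_eq a) fun a b hab => ?_
  cases hu : u.find? (fun t => decide (b ∈ F t)) with
  | none =>
    rw [count_pre_flatMap_of_find?_none hu,
      count_pre_flatMap_of_find?_none (h.find?_eq _ ▸ hu)]
    exact (h.perm.map _).sum_eq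
  | some z =>
    have hv : v.find? (fun t => decide (b ∈ F t)) = some z := h.find?_eq _ ▸ hu
    rw [count_pre_flatMap_of_find? hu, count_pre_flatMap_of_find? hv]
    congr 1
    have hz : b ∈ F z := by simpa using List.find?_some hu
    have hcases : (a = 1 ∧ b = 2) ∨ (a = 0 ∧ b = 2) ∨ (a = 0 ∧ b = 1) := by
      clear hu hv hz; revert hab; revert a b; decide
    rcases hcases with ⟨rfl, rfl⟩ | ⟨rfl, rfl⟩ | ⟨rfl, rfl⟩
    · exact sum_map_eq_of_st_invariant (fun x => hst x 1) fun x => h.count_add x z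
    -- No `2` occurs before `z`, so adding the number of `2`s changes nothing and makes the weight
    -- invariant under `*`.
    · have key : ∀ l : List Letter, (∀ t ∈ l, 2 ∉ F t) →
          (l.map fun t => (F t).count 0) = l.map fun t => (F t).count 0 + (F t).count 2 :=
        fun l hl => List.map_congr_left fun t ht => by
          rw [List.count_eq_zero.2 (hl t ht), add_zero]
      rw [key _ fun t ht => by simpa using not_of_mem_pre_of_find? hu ht,
        key _ fun t ht => by simpa using not_of_mem_pre_of_find? hv ht]
      refine sum_map_eq_of_st_invariant (fun x => ?_) fun x => h.count_add x z
      rw [hst, hst, add_comm]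
      rfl
    -- The letter `1` is fixed by the involution, so `z.st` has a `1` in its image as well and
    -- cannot precede `z`.
    · have hz' : z.st ∉ pre z u := fun hmem => by
        refine not_of_mem_pre_of_find? hu hmem ?_
        have := hst z 1
        simpa using List.count_pos_iff.1 (this ▸ List.count_pos_iff.2 hz)
      exact ((List.perm_iff_count.2 fun x => h.count_pre x z hz').map _).sum_eq

end LeftSim

namespace SameTreeL

variable {u v : List Letter}

theorem count_eq (h : SameTreeL u v) {F : Letter → List (Fin 3)} (hF : Equivariant F)
    (a : Fin 3) : (u.flatMap F).count a = (v.flatMap F).count a := by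
  rw [← labelCount_treeL, h F hF, labelCount_treeL]

theorem count_pre_eq (h : SameTreeL u v) {F : Letter → List (Fin 3)} (hF : Equivariant F)
    {a b : Fin 3} (hab : a ⋖ b) :
    (pre b (u.flatMap F)).count a = (pre b (v.flatMap F)).count a := by
  rw [← labelPre_treeL hab, h F hF, labelPre_treeL hab]

/-- Provides the second variable of `substTwo` when it is to be erased. -/
theorem exists_other (z : Letter) : ∃ x : Letter, x ≠ z ∧ x ≠ z.st := by
  refine ⟨.inl (z.base + 1), ?_⟩
  have : ¬ Letter.base (.inl (z.base + 1)) = z.base := Nat.succ_ne_self _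
  rwa [Letter.base_eq_iff, not_or] at this

theorem count (h : SameTreeL u v) (x : Letter) : u.count x = v.count x := by
  obtain ⟨y, hy, hy'⟩ := exists_other x
  -- Here `x.st` is sent to `[2]`, so the letter `0` counts `x` alone.
  have := h.count_eq (equivariant_substTwo (w := [0]) (w' := []) hy hy') 0
  rw [count_flatMap, count_flatMap, sum_count_substTwo hy hy', sum_count_substTwo hy hy'] at this
  simpa [sharpWord] using this

theorem perm (h : SameTreeL u v) : u.Perm v := List.perm_iff_count.2 h.count

theorem covBy_one_two : (1 : Fin 3) ⋖ 2 := ⟨by decide, fun c => by revert c; decide⟩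

theorem covBy_zero_one : (0 : Fin 3) ⋖ 1 := ⟨by decide, fun c => by revert c; decide⟩

theorem mem_substTwo {z x t : Letter} {w w' : List (Fin 3)} (hzx : x ≠ z)
    (hzx' : x ≠ z.st) {b : Fin 3}
    (ht : b ∈ substTwo z w x w' t) :
    (t = z ∧ b ∈ w) ∨ (t = z.st ∧ b ∈ sharpWord w) ∨ (t = x ∧ b ∈ w') ∨
      (t = x.st ∧ b ∈ sharpWord w') := by
  unfold substTwo at ht
  split_ifs at ht <;> simp_all

/-- If `y` came first in `v`, a substitution putting `2` in the images of both `x` and `y` would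
give different numbers of `1` before the first `2`. -/
theorem mem_pre_imp (h : SameTreeL u v) {x y : Letter} (hx : x ∈ pre y u) : x ∈ pre y v := by
  by_contra hxv
  have hne : x ≠ y := ne_of_mem_pre hx
  have hxu := mem_of_mem_pre hx
  have hyv : y ∈ v := by
    by_contra hyv
    rw [pre_of_not_mem hyv] at hxv
    exact hxv (h.perm.mem_iff.1 hxu)
  have hyx : y ∉ pre x u := not_mem_pre_of_mem_pre hx
  have hxv' := h.perm.mem_iff.1 hxu
  by_cases hst : y = x.st
  · subst hst
    obtain ⟨z, hz, hz'⟩ := exists_other x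
    -- The image of `x` has its `1` before its `2`, whereas that of `x.st` is `[0, 2, 1]`. The count
    -- is thus 1 for `u` and 0 for `v`.
    have e := h.count_pre_eq (equivariant_substTwo (w := [1, 0, 2]) (w' := []) hz hz')
      covBy_one_two
    rw [count_pre_flatMap_of_find? (z := x) (find?_eq_some_of_pre hxu _ _),
      count_pre_flatMap_of_find? (z := x.st) (find?_eq_some_of_pre hyv _ _),
      sum_count_substTwo hz hz', sum_count_substTwo hz hz', substTwo_left,
      substTwo_left_st, List.count_eq_zero.2 hxv, List.count_eq_zero.2 (not_mem_pre x u),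
      List.count_eq_zero.2 hyx, List.count_eq_zero.2 (not_mem_pre x.st v)] at e
    · simp [sharpWord, pre_cons] at e
    · simp [substTwo_left_st, sharpWord]
    · intro t ht hmem
      rcases mem_substTwo hz hz' (of_decide_eq_true hmem) with h1 | h1 | h1 | h1
      · exact hxv (h1.1 ▸ ht)
      · exact not_mem_pre x.st v (h1.1 ▸ ht)
      · simp at h1
      · simp [sharpWord] at h1
    · simp [substTwo_left]
    · intro t ht hmem
      rcases mem_substTwo hz hz' (of_decide_eq_true hmem) with h1 | h1 | h1 | h1
      · exact not_mem_pre x u (h1.1 ▸ ht)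
      · exact hyx (h1.1 ▸ ht)
      · simp at h1
      · simp [sharpWord] at h1
  · have key : ∀ w : List (Fin 3), 2 ∈ w → 2 ∉ sharpWord w →
        (pre x u).count x * w.count 1 + (pre x u).count x.st * (sharpWord w).count 1 +
            (pre 2 w).count 1 =
          (pre y v).count x * w.count 1 + (pre y v).count x.st * (sharpWord w).count 1 := by
      intro w hw hw'
      have e := h.count_pre_eq
        (equivariant_substTwo (w := w) (w' := [2]) hne.symm hst) covBy_one_two
      rw [count_pre_flatMap_of_find? (z := x) (find?_eq_some_of_pre hxu _ _),
        count_pre_flatMap_of_find? (z := y) (find?_eq_some_of_pre hyv _ _),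
        sum_count_substTwo hne.symm hst, sum_count_substTwo hne.symm hst, substTwo_left,
        substTwo_right hne.symm hst] at e
      · simpa [sharpWord] using e
      · simp [substTwo_right hne.symm hst]
      · intro t ht hmem
        rcases mem_substTwo hne.symm hst (of_decide_eq_true hmem) with
          h1 | h1 | h1 | h1
        · exact hxv (h1.1 ▸ ht)
        · exact hw' h1.2
        · exact not_mem_pre y v (h1.1 ▸ ht)
        · simp [sharpWord] at h1
      · simpa [substTwo_left] using hw
      · intro t ht hmem
        rcases mem_substTwo hne.symm hst (of_decide_eq_true hmem) with
          h1 | h1 | h1 | h1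
        · exact not_mem_pre x u (h1.1 ▸ ht)
        · exact hw' h1.2
        · exact hyx (h1.1 ▸ ht)
        · simp [sharpWord] at h1
    -- Moving the `1` across the `2` in the image of `x` raises the count for `u` by one and leaves
    -- the count for `v` unchanged.
    have e1 := key [2, 1] (by decide) (by decide)
    have e2 := key [1, 2] (by decide) (by decide)
    simp [sharpWord, pre_cons] at e1 e2
    omega

theorem mem_pre (h : SameTreeL u v) (x y : Letter) : x ∈ pre y u ↔ x ∈ pre y v :=
  ⟨h.mem_pre_imp, SameTreeL.mem_pre_imp fun F hF => (h F hF).symm⟩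

theorem leftSim (h : SameTreeL u v) : LeftSim u v where
  count := h.count
  mem_pre := h.mem_pre
  count_add x z := by
    by_cases hzu : z ∈ u
    · have hzv := h.perm.mem_iff.1 hzu
      have main : ∀ {y : Letter} (w w' : List (Fin 3)), y ≠ z → y ≠ z.st → 2 ∈ w →
          2 ∉ sharpWord w → 2 ∉ w' → 2 ∉ sharpWord w' →
          (pre z u).count z * w.count 1 + (pre z u).count z.st * (sharpWord w).count 1 +
            (pre z u).count y * w'.count 1 + (pre z u).count y.st * (sharpWord w').count 1 =
          (pre z v).count z * w.count 1 + (pre z v).count z.st * (sharpWord w).count 1 +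
            (pre z v).count y * w'.count 1 + (pre z v).count y.st * (sharpWord w').count 1 := by
        intro y w w' hy hy' h1 h2 h3 h4
        have hfind : ∀ u : List Letter, z ∈ u →
            u.find? (fun t => decide (2 ∈ substTwo z w y w' t)) = some z := by
          refine fun u hz => find?_eq_some_of_pre hz (by simpa [substTwo_left]) ?_
          intro t ht hmem
          rcases mem_substTwo hy hy' (of_decide_eq_true hmem) with
            h5 | h5 | h5 | h5
          · exact not_mem_pre z u (h5.1 ▸ ht)
          · exact h2 h5.2
          · exact h3 h5.2
          · exact h4 h5.2
        have e := h.count_pre_eq (equivariant_substTwo (w := w) (w' := w') hy hy') covBy_one_two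
        rw [count_pre_flatMap_of_find? (hfind u hzu), count_pre_flatMap_of_find? (hfind v hzv),
          sum_count_substTwo hy hy', sum_count_substTwo hy hy'] at e
        -- The part of the image of `z` before its first `2` contributes equally on both sides.
        exact Nat.add_right_cancel e
      by_cases hx : x.base = z.base
      · obtain ⟨y, hy, hy'⟩ := exists_other z
        -- Now `z.st` is sent to `[1, 0]`, so each occurrence of `z.st` before `z` is counted once.
        have e := main [2, 1] [] hy hy' (by decide) (by decide) (by decide) (by decide)
        simp [sharpWord] at e
        rcases Letter.base_eq_iff.1 hx with rfl | rfl
        · exact e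
        · rw [Letter.st_st, add_comm, e, add_comm]
      · rw [Letter.base_eq_iff, not_or] at hx
        -- Both `x` and `x.st` are sent to `[1]`, while `z` carries the only `2`.
        have e := main [2] [1] hx.1 hx.2 (by decide) (by decide) (by decide) (by decide)
        simpa [sharpWord, List.count_eq_zero.2 (not_mem_pre z _)] using e
    · rw [pre_of_not_mem hzu, pre_of_not_mem fun hz => hzu (h.perm.mem_iff.2 hz), h.count,
        h.count]
  count_pre x z hz := by
    by_cases hzu : z ∈ u
    · have hzv := h.perm.mem_iff.1 hzu
      by_cases hx : x.base = z.base
      · rcases Letter.base_eq_iff.1 hx with rfl | rfl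
        · rw [List.count_eq_zero.2 (not_mem_pre _ _), List.count_eq_zero.2 (not_mem_pre _ _)]
        · rw [List.count_eq_zero.2 hz, List.count_eq_zero.2 (mt (h.mem_pre _ _).2 hz)]
      · rw [Letter.base_eq_iff, not_or] at hx
        -- Both `z` and `z.st` are sent to `[1]`, so `z` gives the first `1` only because `z.st`
        -- does not precede it. As `x.st` is sent to `[2]`, the `0`s count `x` alone.
        have hfind : ∀ u : List Letter, z ∈ u → z.st ∉ pre z u →
            u.find? (fun t => decide (1 ∈ substTwo z [1] x [0] t)) = some z := by
          refine fun u hz hz' => find?_eq_some_of_pre hz (by simp [substTwo_left]) ?_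
          intro t ht hmem
          rcases mem_substTwo hx.1 hx.2 (of_decide_eq_true hmem) with
            h5 | h5 | h5 | h5
          · exact not_mem_pre z u (h5.1 ▸ ht)
          · exact hz' (h5.1 ▸ ht)
          · simp at h5
          · simp [sharpWord] at h5
        have e := h.count_pre_eq (equivariant_substTwo (w := [1]) (w' := [0]) hx.1 hx.2)
          covBy_zero_one
        rw [count_pre_flatMap_of_find? (hfind u hzu hz),
          count_pre_flatMap_of_find? (hfind v hzv (mt (h.mem_pre _ _).2 hz)),
          sum_count_substTwo hx.1 hx.2, sum_count_substTwo hx.1 hx.2] at e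
        simpa [sharpWord] using e
    · rw [pre_of_not_mem hzu, pre_of_not_mem fun hz => hzu (h.perm.mem_iff.2 hz), h.count]

end SameTreeL

theorem sameTreeL_iff_leftSim {u v : List Letter} : SameTreeL u v ↔ LeftSim u v :=
  ⟨SameTreeL.leftSim, LeftSim.sameTreeL⟩

/-! ### The one-sided conditions -/

theorem mem_proj {t x y : Letter} {u : List Letter} :
    t ∈ proj u x y ↔ t ∈ u ∧ (t.base = x.base ∨ t.base = y.base) := by
  simp [proj]

theorem count_proj {t x y : Letter} (ht : t.base = x.base ∨ t.base = y.base) (u : List Letter) :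
    (proj u x y).count t = u.count t :=
  List.count_filter (by simpa using ht)

theorem prefix_proj_iff {u a : List Letter} {x y z : Letter}
    (hz : z.base = x.base ∨ z.base = y.base) (ha : z ∉ a) :
    a ++ [z] <+: proj u x y ↔ z ∈ u ∧ proj (pre z u) x y = a := by
  rw [append_singleton_prefix_iff ha, mem_proj, and_iff_left hz, proj,
    pre_filter (by simpa using hz)]
  rfl

theorem proj_swap (u : List Letter) (x y : Letter) : proj u y x = proj u x y := by
  simp only [proj, or_comm]

theorem proj_st (u : List Letter) (x y : Letter) : proj u x y.st = proj u x y := by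
  simp only [proj, Letter.base_st]

theorem proj_st_left (u : List Letter) (x y : Letter) : proj u x.st y = proj u x y := by
  simp only [proj, Letter.base_st]

/-- The parts of conditions (I)–(V) that concern prefixes. -/
structure LeftCond (u v : List Letter) (x y : Letter) : Prop where
  one : ∀ α : ℕ, 1 ≤ α → List.replicate α x ++ [x.st] <+: proj u x y →
    List.replicate α x ++ [x.st] <+: proj v x y
  two : ∀ α : ℕ, 1 ≤ α → List.replicate α y ++ [x] <+: proj u x y →
    List.replicate α y ++ [x] <+: proj v x y
  three : ∀ a : List Letter, ContentEq a x.st y.st → a ++ [x] <+: proj u x y →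
    ∃ a' : List Letter, IsPermutation a' a ∧ a' ++ [x] <+: proj v x y
  four : occBefore y x u + occBefore y x.st u = occBefore y x v + occBefore y x.st v
  five : ∀ a : List Letter, ContentEq a x x.st → a ++ [y] <+: proj u x y →
    ∃ a' : List Letter, IsPermutation a' a ∧ a' ++ [y] <+: proj v x y

/-- Retaining variables commutes with reversal, which exchanges prefixes and suffixes. -/
theorem conds_iff_leftCond {u v : List Letter} {x y : Letter} :
    (CondI u v x y ∧ CondII u v x y ∧ CondIII u v x y ∧ CondIV u v x y ∧ CondV u v x y) ↔
      LeftCond u v x y ∧ LeftCond u.reverse v.reverse x y := by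
  have hproj : ∀ u : List Letter, proj u.reverse x y = (proj u x y).reverse := fun u => by
    simp [proj, List.filter_reverse]
  have hrep : ∀ (w : List Letter) (α : ℕ) (s t : Letter),
      List.replicate α s ++ [t] <+: w.reverse ↔ [t] ++ List.replicate α s <:+ w := by
    intro w α s t
    rw [← List.reverse_prefix]
    simp
  have hrev : ∀ (w a : List Letter) (t : Letter), a ++ [t] <+: w.reverse ↔
      [t] ++ a.reverse <:+ w := by
    intro w a t
    rw [← List.reverse_prefix]
    simp
  have hafter : ∀ (s t : Letter) (w : List Letter), occBefore s t w.reverse = occAfter s t w := by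
    intro s t w
    simp [occBefore, occAfter, occ, List.rtakeWhile]
  have hcon : ∀ (a : List Letter) (s t : Letter),
      ContentEq a.reverse s t ↔ ContentEq a s t := by
    intro a s t
    simp [ContentEq]
  have hperm : ∀ a b : List Letter, IsPermutation a.reverse b.reverse ↔ IsPermutation a b := by
    intro a b
    simp [IsPermutation, occ]
  have hexists : ∀ (s t r : Letter),
      (∀ a : List Letter, ContentEq a s t → a ++ [r] <+: proj u.reverse x y →
        ∃ a' : List Letter, IsPermutation a' a ∧ a' ++ [r] <+: proj v.reverse x y) ↔
      (∀ a : List Letter, ContentEq a s t → [r] ++ a <:+ proj u x y →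
        ∃ a' : List Letter, IsPermutation a' a ∧ [r] ++ a' <:+ proj v x y) := by
    intro s t r
    simp only [hproj, hrev]
    constructor
    · intro h a ha hp
      obtain ⟨a', h1, h2⟩ := h a.reverse ((hcon _ _ _).2 ha) (by rwa [List.reverse_reverse])
      exact ⟨a'.reverse, by rwa [← hperm, List.reverse_reverse], h2⟩
    · intro h a ha hp
      obtain ⟨a', h1, h2⟩ := h a.reverse ((hcon _ _ _).2 ha) hp
      exact ⟨a'.reverse, by rwa [← hperm, List.reverse_reverse], by rwa [List.reverse_reverse]⟩
  constructor
  · rintro ⟨⟨h1, h1'⟩, ⟨h2, h2'⟩, ⟨h3, h3'⟩, ⟨h4, h4'⟩, ⟨h5, h5'⟩⟩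
    refine ⟨⟨h1, h2, h3, h4, h5⟩, ⟨?_, ?_, (hexists _ _ _).2 h3', ?_, (hexists _ _ _).2 h5'⟩⟩
    · simpa only [hproj, hrep] using h1'
    · simpa only [hproj, hrep] using h2'
    · simpa only [hafter] using h4'
  · rintro ⟨⟨h1, h2, h3, h4, h5⟩, ⟨h1', h2', h3', h4', h5'⟩⟩
    refine ⟨⟨h1, ?_⟩, ⟨h2, ?_⟩, ⟨h3, (hexists _ _ _).1 h3'⟩, ⟨h4, ?_⟩,
      ⟨h5, (hexists _ _ _).1 h5'⟩⟩
    · simpa only [hproj, hrep] using h1'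
    · simpa only [hproj, hrep] using h2'
    · simpa only [hafter] using h4'

theorem count_eq_of_count_add {l l' : List Letter} {x : Letter}
    (hadd : l.count x + l.count x.st = l'.count x + l'.count x.st)
    (hmem : ∀ t, t ∈ l ↔ t ∈ l') (hx : ¬(x ∈ l ∧ x.st ∈ l)) : l.count x = l'.count x := by
  by_cases h : x ∈ l
  · have h1 : x.st ∉ l := fun h' => hx ⟨h, h'⟩
    rwa [List.count_eq_zero.2 h1, List.count_eq_zero.2 (mt (hmem _).2 h1)] at hadd
  · rw [List.count_eq_zero.2 h, List.count_eq_zero.2 (mt (hmem _).2 h)]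

namespace LeftSim

variable {u v : List Letter}

theorem count_pre_of_not_both (h : LeftSim u v) {t z : Letter}
    (ht : ¬(t ∈ pre z u ∧ t.st ∈ pre z u)) : (pre z u).count t = (pre z v).count t :=
  count_eq_of_count_add (h.count_add t z) (fun s => h.mem_pre s z) ht

/-- The order of first occurrences excludes all variables but `t`. Since `t.st` is among the
excluded ones, the sum of the two counts yields the exact exponent. -/
theorem proj_pre_replicate (h : LeftSim u v) {t x y z : Letter} {α : ℕ}
    (ht : t.base = x.base ∨ t.base = y.base)
    (hu : proj (pre z u) x y = List.replicate α t) :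
    proj (pre z v) x y = List.replicate α t := by
  have hmem : ∀ s ∈ proj (pre z u) x y, s = t := fun s hs => by
    rw [hu] at hs
    exact List.eq_of_mem_replicate hs
  have hall : ∀ s ∈ proj (pre z v) x y, t = s := fun s hs =>
    (hmem s (mem_proj.2 ⟨(h.mem_pre s z).2 (mem_proj.1 hs).1, (mem_proj.1 hs).2⟩)).symm
  have hcount : (proj (pre z v) x y).count t = α := by
    rw [count_proj ht, ← h.count_pre_of_not_both, ← count_proj ht, hu,
      List.count_replicate_self]
    rintro ⟨-, h2⟩
    exact Letter.st_ne t (hmem _ (mem_proj.2 ⟨h2, by rwa [Letter.base_st]⟩))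
  rw [List.eq_replicate_iff]
  exact ⟨by rw [← List.count_eq_length.2 hall, hcount], fun s hs => (hall s hs).symm⟩

theorem leftCond (h : LeftSim u v) {x y : Letter} (hy : y ≠ x) (hy' : y ≠ x.st) :
    LeftCond u v x y where
  one α _ hp := by
    have hn : x.st ∉ List.replicate α x := fun h => Letter.st_ne x (List.eq_of_mem_replicate h)
    rw [prefix_proj_iff (by simp) hn] at hp ⊢
    exact ⟨h.perm.mem_iff.1 hp.1, h.proj_pre_replicate (.inl rfl) hp.2⟩
  two α _ hp := by
    have hn : x ∉ List.replicate α y := fun h => hy (List.eq_of_mem_replicate h).symm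
    rw [prefix_proj_iff (by simp) hn] at hp ⊢
    exact ⟨h.perm.mem_iff.1 hp.1, h.proj_pre_replicate (.inr rfl) hp.2⟩
  three a ha hp := by
    have hxy : x ≠ y.st := fun e => hy' (by rw [e, Letter.st_st])
    have hn : x ∉ a := fun hx => by
      rcases (ha x).1 hx with e | e
      · exact Letter.st_ne x e.symm
      · exact hxy e
    rw [prefix_proj_iff (by simp) hn] at hp
    obtain ⟨hxu, rfl⟩ := hp
    refine ⟨proj (pre x v) x y, fun s => ?_, (prefix_proj_iff (by simp) ?_).2
      ⟨h.perm.mem_iff.1 hxu, rfl⟩⟩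
    · by_cases hs : s.base = x.base ∨ s.base = y.base
      · rw [occ, occ, count_proj hs, count_proj hs, h.count_pre_of_not_both]
        rintro ⟨h1, h2⟩
        have h1' := (ha s).1 (mem_proj.2 ⟨h1, hs⟩)
        have h2' := (ha s.st).1 (mem_proj.2 ⟨h2, by simpa using hs⟩)
        rcases h1' with rfl | rfl
        · rw [Letter.st_st] at h2
          exact not_mem_pre x u h2
        · rw [Letter.st_st] at h2'
          exact h2'.elim hy' (Letter.st_ne y).symm
      · rw [occ, occ, List.count_eq_zero.2 fun h => hs (mem_proj.1 h).2,
          List.count_eq_zero.2 fun h => hs (mem_proj.1 h).2]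
    · exact fun hm => not_mem_pre x v (mem_proj.1 hm).1
  four := h.count_add x y
  five a ha hp := by
    have hn : y ∉ a := fun h => ((ha y).1 h).elim hy hy'
    rw [prefix_proj_iff (by simp) hn] at hp
    obtain ⟨hyu, rfl⟩ := hp
    -- As `a` consists of `x` and `x.st` only, `y.st` does not precede `y`, so exact counts are
    -- available.
    have hst : y.st ∉ pre y u := fun hm => by
      rcases (ha y.st).1 (mem_proj.2 ⟨hm, by simp⟩) with e | e
      · exact hy' (Letter.st_eq_iff.1 e)
      · exact hy (by rw [← y.st_st, e, x.st_st])
    refine ⟨proj (pre y v) x y, fun s => ?_, (prefix_proj_iff (by simp) ?_).2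
      ⟨h.perm.mem_iff.1 hyu, rfl⟩⟩
    · by_cases hs : s.base = x.base ∨ s.base = y.base
      · rw [occ, occ, count_proj hs, count_proj hs, h.count_pre s y hst]
      · rw [occ, occ, List.count_eq_zero.2 fun h => hs (mem_proj.1 h).2,
          List.count_eq_zero.2 fun h => hs (mem_proj.1 h).2]
    · exact fun hm => not_mem_pre y v (mem_proj.1 hm).1

end LeftSim

/-- With a fresh second variable, `proj` retains only `z` and `z.st`. -/
theorem exists_fresh (u : List Letter) (z : Letter) :
    ∃ y : Letter, y ≠ z ∧ y ≠ z.st ∧ y ∉ u ∧ y.st ∉ u := by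
  obtain ⟨n, hn⟩ := Infinite.exists_notMem_finset ((z :: u).map Letter.base).toFinset
  rw [List.mem_toFinset] at hn
  have key : ∀ t : Letter, t.base = n → t ∉ z :: u := fun t ht hm =>
    hn (ht ▸ List.mem_map_of_mem hm)
  have h1 := key (.inl n) rfl
  have h2 := key (.inr n) rfl
  rw [List.mem_cons, not_or] at h1 h2
  exact ⟨.inl n, h1.1, fun e => h2.1 (Letter.st_eq_iff.2 e), h1.2, h2.2⟩

theorem eq_replicate_count {l : List Letter} {t : Letter} (h : ∀ s ∈ l, s = t) :
    l = List.replicate (l.count t) t :=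
  List.eq_replicate_iff.2 ⟨(List.count_eq_length.2 fun s hs => (h s hs).symm).symm, h⟩

/-! ### From the prefix conditions back to `LeftSim` -/

section Converse

variable {u v : List Letter}

/-- The retained word starts with a power of `x` followed by `w`. This prefix is transferred by
`one` when `w = x.st`, and by `two` for the pair `(w, x)` otherwise. -/
theorem mem_pre_of_first
    (h : ∀ x ∈ u, ∀ y : Letter, y ≠ x → y ≠ x.st → LeftCond u v x y) {x y w : Letter}
    (hy : y ≠ x) (hy' : y ≠ x.st) (hw : w = x.st ∨ w = y ∨ w = y.st) (hwu : w ∈ u)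
    (hxw : x ∈ pre w u) (hfirst : ∀ s ∈ proj (pre w u) x y, s = x) :
    x ∈ pre w v ∧ ∀ s ∈ proj (pre w v) x y, s = x := by
  have hxu := mem_of_mem_pre hxw
  have hrep := eq_replicate_count hfirst
  set α := (proj (pre w u) x y).count x with hα
  have hα1 : 1 ≤ α := List.count_pos_iff.2 (mem_proj.2 ⟨hxw, .inl rfl⟩)
  have hwx : w ≠ x := (ne_of_mem_pre hxw).symm
  have hn : w ∉ List.replicate α x := fun h => hwx (List.eq_of_mem_replicate h)
  have hwb : w.base = x.base ∨ w.base = y.base := by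
    rcases hw with rfl | rfl | rfl <;> simp
  have hpu := (prefix_proj_iff hwb hn).2 ⟨hwu, hrep⟩
  have hpv : List.replicate α x ++ [w] <+: proj v x y := by
    rcases hw with rfl | rfl | rfl
    · exact (h x hxu y hy hy').one α hα1 hpu
    · rw [← proj_swap] at hpu ⊢
      exact (h w hwu x hy.symm fun e => hy' (Letter.st_eq_iff.1 e.symm)).two α hα1 hpu
    · have h1 : x ≠ y.st := fun e => hy' (Letter.st_eq_iff.1 e.symm)
      rw [← proj_st, ← proj_swap] at hpu ⊢
      exact (h y.st hwu x h1 (by rw [Letter.st_st]; exact hy.symm)).two α hα1 hpu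
  have := ((prefix_proj_iff hwb hn).1 hpv).2
  refine ⟨(mem_proj.1 (this ▸ List.mem_replicate.2 ⟨by lia, rfl⟩ : x ∈ proj (pre w v) x y)).1, ?_⟩
  intro s hs
  rw [this] at hs
  exact List.eq_of_mem_replicate hs

theorem proj_pre_st_of_leftCond
    (h : ∀ x ∈ u, ∀ y : Letter, y ≠ x → y ≠ x.st → LeftCond u v x y) {x : Letter}
    (hx : x ∈ pre x.st u) (hxs : x.st ∈ u) :
    (pre x.st v).count x = (pre x.st u).count x := by
  obtain ⟨y, hy, hy', hyu, hyu'⟩ := exists_fresh u x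
  have hall : ∀ s ∈ proj (pre x.st u) x y, s = x := by
    intro s hs
    obtain ⟨h1, h2 | h2⟩ := mem_proj.1 hs
    · rcases Letter.base_eq_iff.1 h2 with h3 | h3
      · exact h3
      · exact absurd h3 (ne_of_mem_pre h1)
    · rcases Letter.base_eq_iff.1 h2 with rfl | rfl
      · exact absurd (mem_of_mem_pre h1) hyu
      · exact absurd (mem_of_mem_pre h1) hyu'
  have hrep := eq_replicate_count hall
  have hn : ∀ α, x.st ∉ List.replicate α x := fun α h =>
    Letter.st_ne x (List.eq_of_mem_replicate h)
  have hpv := (h x (mem_of_mem_pre hx) y hy hy').one _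
    (List.count_pos_iff.2 (mem_proj.2 ⟨hx, .inl rfl⟩))
    ((prefix_proj_iff (by simp) (hn _)).2 ⟨hxs, hrep⟩)
  have := congrArg (List.count x) ((prefix_proj_iff (by simp) (hn _)).1 hpv).2
  rwa [List.count_replicate_self, count_proj (.inl rfl), count_proj (.inl rfl)] at this

/-- Unless `z = x.st`, the variables retained before the first `x` in `u` lie in `{x.st, z.st}`. If
both occur, `three` applies; if exactly one occurs, a pure power precedes `x` and `one` or `two`
applies. If none occurs, the retained word starts with `x`. -/
theorem mem_pre_imp_of_leftCond (hperm : u.Perm v)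
    (h : ∀ x ∈ u, ∀ y : Letter, y ≠ x → y ≠ x.st → LeftCond u v x y) {x z : Letter}
    (hx : x ∈ pre z u) : x ∈ pre z v := by
  have hxu := mem_of_mem_pre hx
  have hxv := hperm.mem_iff.1 hxu
  by_cases hzu : z ∈ u
  swap
  · rwa [pre_of_not_mem fun hz => hzu (hperm.mem_iff.2 hz)]
  have hzx : z ≠ x := (ne_of_mem_pre hx).symm
  by_cases hzs : z = x.st
  · subst hzs
    refine List.count_pos_iff.1 ?_
    rw [proj_pre_st_of_leftCond h hx hzu]
    exact List.count_pos_iff.2 hx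
  have hxz : x ≠ z.st := fun e => hzs (Letter.st_eq_iff.1 e.symm)
  refine mem_pre_of_not_mem_pre hxv hzx fun hzv => ?_
  have hzpre : z ∉ pre x u := not_mem_pre_of_mem_pre hx
  have hcases : ∀ s ∈ proj (pre x u) x z, s = x.st ∨ s = z.st := by
    intro s hs
    obtain ⟨h1, h2 | h2⟩ := mem_proj.1 hs
    · exact .inl ((Letter.base_eq_iff.1 h2).resolve_left (ne_of_mem_pre h1))
    · exact .inr ((Letter.base_eq_iff.1 h2).resolve_left fun e => hzpre (e ▸ h1))
  by_cases h1 : x.st ∈ pre x u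
  · by_cases h2 : z.st ∈ pre x u
    · have hcon : ContentEq (proj (pre x u) x z) x.st z.st := by
        refine fun s => ⟨hcases s, ?_⟩
        rintro (rfl | rfl)
        · exact mem_proj.2 ⟨h1, by simp⟩
        · exact mem_proj.2 ⟨h2, by simp⟩
      obtain ⟨a', ha', hp⟩ := (h x hxu z hzx hzs).three _ hcon
        ((prefix_proj_iff (by simp) fun hm => not_mem_pre x u (mem_proj.1 hm).1).2 ⟨hxu, rfl⟩)
      have hmem : ∀ s, s ∈ a' ↔ s ∈ proj (pre x u) x z := fun s => by
        rw [← List.count_pos_iff, ← List.count_pos_iff]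
        exact iff_of_eq (congrArg (0 < ·) (ha' s))
      have hxa : x ∉ a' := fun hm => not_mem_pre x u (mem_proj.1 ((hmem x).1 hm)).1
      have := ((prefix_proj_iff (by simp) hxa).1 hp).2
      have hz' : z ∈ a' := this ▸ mem_proj.2 ⟨hzv, .inr rfl⟩
      exact hzpre (mem_proj.1 ((hmem z).1 hz')).1
    · have := mem_pre_of_first h (x := x.st) (y := z) (w := x) hzs
        (by rwa [Letter.st_st]) (by simp) hxu h1 (fun s hs => by
          rw [proj_st_left] at hs
          exact (hcases s hs).resolve_right fun e => h2 (e ▸ (mem_proj.1 hs).1))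
      exact hzs (this.2 z (mem_proj.2 ⟨hzv, .inr rfl⟩))
  · by_cases h2 : z.st ∈ pre x u
    · have := mem_pre_of_first h (x := z.st) (y := x) (w := x) hxz
        (by rw [Letter.st_st]; exact hzx.symm) (by simp) hxu h2 (fun s hs => by
          rw [proj_st_left, proj_swap] at hs
          exact (hcases s hs).resolve_left fun e => h1 (e ▸ (mem_proj.1 hs).1))
      exact (Letter.st_ne z).symm (this.2 z (mem_proj.2 ⟨hzv, by simp⟩))
    -- Let `w` be the first retained variable other than `x`. The transferred prefix shows that in
    -- `v` too `x` precedes `w` and `z` does not, so `x` precedes `z`.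
    · set p : Letter → Bool := fun t => t = x.st ∨ t = z ∨ t = z.st with hp
      obtain ⟨w, hw⟩ : ∃ w, u.find? p = some w := by
        rw [← Option.isSome_iff_exists, List.find?_isSome]
        exact ⟨z, hzu, by simp [hp]⟩
      have hpw : w = x.st ∨ w = z ∨ w = z.st := by simpa [hp] using List.find?_some hw
      have hwu := List.mem_of_find?_eq_some hw
      have hwx : w ≠ x := by
        rcases hpw with rfl | rfl | rfl
        · exact Letter.st_ne x
        · exact hzx
        · exact hxz.symm
      have hxw : x ∈ pre w u := mem_pre_of_not_mem_pre hxu hwx <| by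
        rcases hpw with rfl | rfl | rfl <;> assumption
      have hfirst : ∀ s ∈ proj (pre w u) x z, s = x := by
        intro s hs
        obtain ⟨h3, h4⟩ := mem_proj.1 hs
        have h5 := not_of_mem_pre_of_find? hw h3
        rw [Letter.base_eq_iff, Letter.base_eq_iff] at h4
        simp only [hp, decide_eq_true_eq] at h5
        tauto
      have hv := mem_pre_of_first h hzx hzs hpw hwu hxw hfirst
      have hznw : z ∉ pre w v := fun hm => hzx (hv.2 z (mem_proj.2 ⟨hm, .inr rfl⟩))
      exact not_mem_pre_of_mem_pre hzv (mem_pre_trans hv.1 hznw)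

theorem leftSim_of_leftCond (hperm : u.Perm v)
    (h : ∀ x ∈ u, ∀ y : Letter, y ≠ x → y ≠ x.st → LeftCond u v x y) : LeftSim u v := by
  -- One implication suffices, because the order of first occurrences is total and asymmetric.
  have hmem : ∀ x z : Letter, x ∈ pre z u ↔ x ∈ pre z v := by
    refine fun x z => ⟨mem_pre_imp_of_leftCond hperm h, fun hx => ?_⟩
    by_cases hzu : z ∈ u
    · refine mem_pre_of_not_mem_pre (hperm.mem_iff.2 (mem_of_mem_pre hx))
        (ne_of_mem_pre hx).symm fun hz => ?_
      exact not_mem_pre_of_mem_pre hx (mem_pre_imp_of_leftCond hperm h hz)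
    · rw [pre_of_not_mem hzu]
      exact hperm.mem_iff.2 (mem_of_mem_pre hx)
  have hst : ∀ z : Letter, (pre z u).count z.st = (pre z v).count z.st := by
    intro z
    by_cases hz : z.st ∈ pre z u
    · by_cases hzu : z ∈ u
      · have := proj_pre_st_of_leftCond h (x := z.st) (by rwa [Letter.st_st])
          (by rwa [Letter.st_st])
        rw [Letter.st_st] at this
        exact this.symm
      · rw [pre_of_not_mem hzu, pre_of_not_mem (mt hperm.mem_iff.2 hzu), hperm.count_eq]
    · rw [List.count_eq_zero.2 hz, List.count_eq_zero.2 (mt (hmem _ _).2 hz)]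
  have hself : ∀ z : Letter, (pre z u).count z = (pre z v).count z := fun z => by
    rw [List.count_eq_zero.2 (not_mem_pre _ _), List.count_eq_zero.2 (not_mem_pre _ _)]
  have hadd : ∀ x z : Letter,
      (pre z u).count x + (pre z u).count x.st = (pre z v).count x + (pre z v).count x.st := by
    intro x z
    by_cases hxz : x = z
    · rw [hxz, hself, hst]
    by_cases hxz' : x = z.st
    · rw [hxz', Letter.st_st, hself, hst]
    by_cases hxu : x ∈ u
    · exact (h x hxu z (Ne.symm hxz) fun e => hxz' (Letter.st_eq_iff.1 e.symm)).four
    -- `four` is available only for variables of `u`, but its sum is symmetric in `x` and `x.st`.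
    by_cases hxu' : x.st ∈ u
    · have := (h x.st hxu' z (fun e => hxz' (Letter.st_eq_iff.1 e.symm))
        (by rw [Letter.st_st]; exact Ne.symm hxz)).four
      simp only [occBefore, occ, Letter.st_st] at this
      rw [add_comm, add_comm ((pre z v).count x)]
      exact this
    · have hz : ∀ t, t ∉ u → (pre z u).count t = (pre z v).count t := fun t ht => by
        have h1 : t ∉ pre z u := fun hm => ht (mem_of_mem_pre hm)
        rw [List.count_eq_zero.2 h1, List.count_eq_zero.2 (mt (hmem _ _).2 h1)]
      rw [hz x hxu, hz _ hxu']
  refine ⟨hperm.count_eq, hmem, hadd, fun x z hz => ?_⟩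
  by_cases hboth : x ∈ pre z u ∧ x.st ∈ pre z u
  swap
  · exact count_eq_of_count_add (hadd x z) (fun t => hmem t z) hboth
  by_cases hzu : z ∈ u
  swap
  · rw [pre_of_not_mem hzu, pre_of_not_mem (mt hperm.mem_iff.2 hzu), hperm.count_eq]
  have hzx : z ≠ x := (ne_of_mem_pre hboth.1).symm
  have hzx' : z ≠ x.st := (ne_of_mem_pre hboth.2).symm
  have hcon : ContentEq (proj (pre z u) x z) x x.st := by
    refine fun s => ⟨fun hs => ?_, ?_⟩
    · obtain ⟨h1, h2 | h2⟩ := mem_proj.1 hs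
      · exact Letter.base_eq_iff.1 h2
      · rcases Letter.base_eq_iff.1 h2 with rfl | rfl
        · exact absurd h1 (not_mem_pre _ _)
        · exact absurd h1 hz
    · rintro (rfl | rfl)
      · exact mem_proj.2 ⟨hboth.1, .inl rfl⟩
      · exact mem_proj.2 ⟨hboth.2, by simp⟩
  obtain ⟨a', ha', hp⟩ := (h x (mem_of_mem_pre hboth.1) z hzx hzx').five _ hcon
    ((prefix_proj_iff (by simp) fun hm => not_mem_pre z u (mem_proj.1 hm).1).2 ⟨hzu, rfl⟩)
  have hza : z ∉ a' := fun hm => by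
    have hm' := List.count_pos_iff.2 hm
    rw [show a'.count z = _ from ha' z] at hm'
    exact not_mem_pre z u (mem_proj.1 (List.count_pos_iff.1 hm')).1
  have e := ha' x
  rwa [← ((prefix_proj_iff (by simp) hza).1 hp).2, occ, occ, count_proj (.inl rfl),
    count_proj (.inl rfl), eq_comm] at e

end Converse

theorem leftSim_iff_leftCond {u v : List Letter} :
    LeftSim u v ↔
      u.Perm v ∧ ∀ x ∈ u, ∀ y : Letter, y ≠ x → y ≠ x.st → LeftCond u v x y :=
  ⟨fun h => ⟨h.perm, fun _ _ _ hy hy' => h.leftCond hy hy'⟩,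
    fun h => leftSim_of_leftCond h.1 h.2⟩

theorem balanced_iff_perm {u v : List Letter} : Balanced u v ↔ u.Perm v := by
  rw [List.perm_iff_count]
  refine ⟨fun h x => ?_, fun h x _ => h x⟩
  by_cases hx : x ∈ u ++ v
  · exact h x hx
  · rw [List.mem_append, not_or] at hx
    rw [List.count_eq_zero.2 hx.1, List.count_eq_zero.2 hx.2]

/-! ### Identities of the Baxter monoid of rank 3 -/

theorem Baxt.mk_eq_mk {n : ℕ} {u v : List (Fin n)} :
    Baxt.mk u = Baxt.mk v ↔ baxterP u = baxterP v :=
  Con.eq (baxterCon n)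

theorem Baxt.mk_surjective {n : ℕ} : Function.Surjective (Baxt.mk (n := n)) := fun x => by
  induction x using Quotient.inductionOn with
  | h w => exact ⟨w.toList, rfl⟩

theorem evalWord_mk {F : Letter → List (Fin 3)} (hF : Equivariant F) (u : List Letter) :
    evalWord (fun i => Baxt.mk (F (.inl i))) u = Baxt.mk (u.flatMap F) := by
  induction u with
  | nil => rfl
  | cons t u ih =>
    have ht : Sum.elim (fun i => Baxt.mk (F (.inl i)))
        (fun i => star (Baxt.mk (F (.inl i)))) t = Baxt.mk (F t) := by
      cases t with
      | inl i => rfl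
      | inr i => exact (congrArg Baxt.mk (hF (.inl i))).symm
    have hcons : evalWord (fun i => Baxt.mk (F (.inl i))) (t :: u) =
        Baxt.mk (F t) * evalWord (fun i => Baxt.mk (F (.inl i))) u := by
      rw [← ht]
      exact List.prod_cons
    rw [hcons, ih]
    rfl

/-- Choosing a word for each `φ i`, and its image under `sharpWord` for the starred variable, lifts
every substitution to an equivariant one. -/
theorem satisfies_iff_baxterP {u v : List Letter} : Satisfies (Baxt 3) u v ↔
    ∀ F, Equivariant F → baxterP (u.flatMap F) = baxterP (v.flatMap F) := by
  constructor
  · intro h F hF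
    rw [← Baxt.mk_eq_mk, ← evalWord_mk hF, ← evalWord_mk hF, h]
  · intro h φ
    choose f hf using fun i => Baxt.mk_surjective (φ i)
    have hF : Equivariant (Sum.elim f fun i => sharpWord (f i)) := by
      rintro (i | i)
      · rfl
      · exact (sharpWord_sharpWord (f i)).symm
    have := Baxt.mk_eq_mk.2 (h _ hF)
    rw [← evalWord_mk hF, ← evalWord_mk hF] at this
    simpa only [Sum.elim_inl, hf] using this

theorem sharpWord_flatMap (F : Letter → List (Fin 3)) (u : List Letter) :
    sharpWord (u.flatMap F) = u.reverse.flatMap fun t => sharpWord (F t) := by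
  simp [sharpWord, List.map_flatMap, List.reverse_flatMap, Function.comp_def]

/-- The right tree for `F` on `u` corresponds to the left tree for `sharpWord ∘ F` on `u.reverse`,
and `F ↦ sharpWord ∘ F` is an involution on equivariant substitutions. -/
theorem satisfies_iff_sameTreeL {u v : List Letter} : Satisfies (Baxt 3) u v ↔
    SameTreeL u v ∧ SameTreeL u.reverse v.reverse := by
  have hsharp : ∀ {F}, Equivariant F → Equivariant fun t => sharpWord (F t) :=
    fun hF t => congrArg sharpWord (hF t)
  simp only [satisfies_iff_baxterP, baxterP, Prod.mk.injEq, treeR_eq_iff, sharpWord_flatMap]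
  refine ⟨fun h => ⟨fun F hF => (h F hF).1, fun F hF => ?_⟩,
    fun h F hF => ⟨h.1 F hF, h.2 _ (hsharp hF)⟩⟩
  simpa only [sharpWord_sharpWord] using (h _ (hsharp hF)).2
end Baxter

/-- A word identity `u ≈ v` holds in the Baxter monoid of rank 3 with Schützenberger's involution
if and only if it is balanced and satisfies conditions (I)–(V) for every variable `x` occurring
in `u` and every variable `y` different from `x` and `x*`. -/
theorem mainTheorem5 (u v : List Baxter.Letter) (hu : u ≠ []) (hv : v ≠ []) :
    Baxter.Satisfies (Baxter.Baxt 3) u v ↔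
      Baxter.Balanced u v ∧
        ∀ x ∈ u, ∀ y : Baxter.Letter, y ≠ x → y ≠ x.st →
          Baxter.CondI u v x y ∧ Baxter.CondII u v x y ∧ Baxter.CondIII u v x y ∧
            Baxter.CondIV u v x y ∧ Baxter.CondV u v x y := by
  simp only [Baxter.conds_iff_leftCond, Baxter.satisfies_iff_sameTreeL,
    Baxter.sameTreeL_iff_leftSim, Baxter.leftSim_iff_leftCond, Baxter.balanced_iff_perm,
    List.reverse_perm', List.perm_reverse, List.mem_reverse]
  constructor
  · rintro ⟨⟨hp, h1⟩, -, h2⟩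
    exact ⟨hp, fun x hx y hy hy' => ⟨h1 x hx y hy hy', h2 x hx y hy hy'⟩⟩
  · rintro ⟨hp, h⟩
    exact ⟨⟨hp, fun x hx y hy hy' => (h x hx y hy hy').1⟩,
      hp, fun x hx y hy hy' => (h x hx y hy hy').2⟩
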